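/- Let $\mathbb{K}$ be a field of characteristic zero with algebraic closure $\mathbb{F}$, let $\alpha\in\mathbb{F}$, and put $n=[\mathbb{K}(\alpha):\mathbb{K}]$. Let $a,b,d\in\mathbb{K}(\alpha)$ with $ad-b\neq 0$, and write \[\frac{at+b}{t+d}=\psi_0(t)+\alpha\,\psi_1(t)+\cdots+\alpha^{n-1}\psi_{n-1}(t),\qquad \psi_0,\ldots,\psi_{n-1}\in\mathbb{K}(t),\] which is possible in exactly one way. Let $\mathcal{U}\subseteq\mathbb{F}^n$ be the curve parametrized by $(\psi_0,\ldots,\psi_{n-1})$, that is, the Zariski closure of the set of points $(\psi_0(s),\ldots,\psi_{n-1}(s))$, where $s\in\mathbb{F}$ runs over the values at which all $\psi_i$ are defined; it is called the $\alpha$-hypercircle associated to $\frac{at+b}{t+d}$ for the extension $\mathbb{K}\subseteq\mathbb{K}(\alpha)$. Embed $\mathbb{F}^n$ in $\mathbb{P}^n(\mathbb{F})$ by $x\mapsto[x_0:\cdots:x_{n-1}:1]$. A point at infinity of $\mathcal{U}$ is a point $[a_0:\cdots:a_{n-1}:0]$ of the projective closure of $\mathcal{U}$. (1) Let $[a_0:\cdots:a_{n-1}:0]$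 be a point at infinity of $\mathcal{U}$ with $a_0,\ldots,a_{n-1}\in\mathbb{K}(\alpha)$, and let $i$ be an index with $a_i\neq0$. Then the field $\mathbb{K}(a_0/a_i,\ldots,a_{n-1}/a_i)$ is $\mathbb{K}$-isomorphic to $\mathbb{K}(d)$. (2) There is a point at infinity $[b_0:\cdots:b_{n-1}:0]$ of $\mathcal{U}$ with $b_0,\ldots,b_{n-1}\in\mathbb{K}(\alpha)$ such that $\mathbb{K}(b_0/b_i,\ldots,b_{n-1}/b_i)=\mathbb{K}(d)$ for every index $i$ with $b_i\neq 0$. Moreover $b_i\neq0$ for every index $i$ for which some point at infinity as in (1) has $a_i\neq0$. -/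

import Mathlib

open Polynomial IntermediateField
open scoped LinearAlgebra.Projectivization

namespace Hypercircle

noncomputable section

/-- The canonical inclusion `K(t) → L(t)` of fields of rational functions. -/
def ratFuncMap (K L : Type*) [Field K] [Field L] [Algebra K L] : RatFunc K →+* RatFunc L :=
  RatFunc.mapRingHom (Polynomial.mapRingHom (algebraMap K L))
    (nonZeroDivisors_le_comap_nonZeroDivisors_of_injective _
      (Polynomial.map_injective _ (algebraMap K L).injective))

theorem ratFuncMap_algebraMap (K L : Type*) [Field K] [Field L] [Algebra K L] (p : K[X]) :
    ratFuncMap K L (algebraMap K[X] (RatFunc K) p) =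
      algebraMap L[X] (RatFunc L) (p.map (algebraMap K L)) := by
  have h := RatFunc.map_apply_div (Polynomial.mapRingHom (algebraMap K L))
    (nonZeroDivisors_le_comap_nonZeroDivisors_of_injective _
      (Polynomial.map_injective _ (algebraMap K L).injective)) p 1
  simpa [ratFuncMap, RatFunc.coe_mapRingHom_eq_coe_map] using h

section Components

variable {K : Type*} [Field K] {F : Type*} [Field F] [Algebra K F]

/-- The power basis `1, α, …, α ^ (n - 1)` of `K(α)` over `K`, where `n = [K(α) : K]`. -/
theorem exists_powerBasis [Algebra.IsAlgebraic K F] (α : F) :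
    ∃ b : Module.Basis (Fin (Module.finrank K K⟮α⟯)) K K⟮α⟯,
      ∀ i, b i = AdjoinSimple.gen K α ^ (i : ℕ) := by
  have hα : IsIntegral K α := (Algebra.IsAlgebraic.isAlgebraic α).isIntegral
  have hn : (adjoin.powerBasis hα).dim = Module.finrank K K⟮α⟯ :=
    (adjoin.powerBasis hα).finrank.symm
  refine ⟨(adjoin.powerBasis hα).basis.reindex (finCongr hn), fun i => ?_⟩
  simp

theorem algebraMap_sum_coord {ι L : Type*} [Fintype ι] [Field L] [Algebra K L]
    (b : Module.Basis ι K L) (p : L[X]) :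
    ∃ c : ι → K[X], p = ∑ i, Polynomial.C (b i) * (c i).map (algebraMap K L) := by
  induction p using Polynomial.induction_on' with
  | add p q hp hq =>
    obtain ⟨c, hc⟩ := hp
    obtain ⟨d, hd⟩ := hq
    refine ⟨c + d, ?_⟩
    conv_lhs => rw [hc, hd]
    simp [mul_add, Finset.sum_add_distrib]
  | monomial k a =>
    refine ⟨fun i => Polynomial.monomial k (b.repr a i), ?_⟩
    conv_lhs => rw [← b.sum_repr a]
    simp [Polynomial.C_mul_monomial, Algebra.smul_def, mul_comm, map_sum]

/-- Every `u ∈ K(α)(t)` can be written in exactly one way as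
`u = ψ₀ + α ψ₁ + ⋯ + α ^ (n - 1) ψₙ₋₁` with `ψᵢ ∈ K(t)`, where `n = [K(α) : K]`. -/
theorem existsUnique_components [Algebra.IsAlgebraic K F] (α : F) (u : RatFunc K⟮α⟯) :
    ∃! ψ : Fin (Module.finrank K K⟮α⟯) → RatFunc K,
      u = ∑ i : Fin (Module.finrank K K⟮α⟯), RatFunc.C (AdjoinSimple.gen K α ^ (i : ℕ)) * ratFuncMap K K⟮α⟯ (ψ i) := by
  obtain ⟨b, hb⟩ := exists_powerBasis (K := K) α
  simp_rw [← hb]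
  refine existsUnique_of_exists_of_unique ?_ ?_
  · obtain ⟨g, hg, e, he⟩ := Polynomial.exists_dvd_map_of_isAlgebraic (R := K) (S := K⟮α⟯)
      (RatFunc.denom_ne_zero u)
    obtain ⟨c, hc⟩ := algebraMap_sum_coord b (u.num * e)
    refine ⟨fun i => algebraMap _ _ (c i) / algebraMap _ _ g, ?_⟩
    have hg' : algebraMap K⟮α⟯[X] (RatFunc K⟮α⟯) (g.map (algebraMap K K⟮α⟯)) ≠ 0 :=
      RatFunc.algebraMap_ne_zero (by simpa [Polynomial.map_eq_zero] using hg)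
    have hd' : algebraMap K⟮α⟯[X] (RatFunc K⟮α⟯) u.denom ≠ 0 :=
      RatFunc.algebraMap_ne_zero (RatFunc.denom_ne_zero u)
    have hu : u = algebraMap _ _ (u.num * e) /
        algebraMap K⟮α⟯[X] (RatFunc K⟮α⟯) (g.map (algebraMap K K⟮α⟯)) := by
      rw [eq_div_iff hg', he, map_mul, map_mul, ← mul_assoc]
      congr 1
      exact (div_eq_iff hd').mp (RatFunc.num_div_denom u) |>.symm
    conv_lhs => rw [hu, hc]
    simp only [map_sum, map_mul, map_div₀, ratFuncMap_algebraMap, Finset.sum_div,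
      RatFunc.algebraMap_C, mul_div_assoc]
  · intro ψ χ h1 h2
    obtain ⟨⟨q, hq⟩, hint⟩ := IsLocalization.exist_integer_multiples_of_finite
      (nonZeroDivisors K[X]) (fun i => ψ i - χ i)
    choose p hp using hint
    have hq0 : q ≠ 0 := nonZeroDivisors.ne_zero hq
    have h0 : ∑ i, RatFunc.C (b i) * ratFuncMap K K⟮α⟯ (ψ i - χ i) = 0 := by
      simp only [map_sub, mul_sub, Finset.sum_sub_distrib, ← h1, ← h2, sub_self]
    have hp' : ∀ i, algebraMap K[X] (RatFunc K) (p i) =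
        algebraMap K[X] (RatFunc K) q * (ψ i - χ i) := by
      intro i
      rw [hp i, ← Algebra.smul_def]
    have h3 : ∑ i, Polynomial.C (b i) * (p i).map (algebraMap K K⟮α⟯) = 0 := by
      apply RatFunc.algebraMap_injective K⟮α⟯
      simp only [map_sum, map_mul, map_zero, ← ratFuncMap_algebraMap, hp', RatFunc.algebraMap_C]
      calc _ = ratFuncMap K K⟮α⟯ (algebraMap _ _ q) *
            ∑ i, RatFunc.C (b i) * ratFuncMap K K⟮α⟯ (ψ i - χ i) := by
              rw [Finset.mul_sum]
              exact Finset.sum_congr rfl fun i _ => by ring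
        _ = 0 := by rw [h0, mul_zero]
    have hpz : ∀ i, p i = 0 := by
      intro i
      ext k
      have h4 := congrArg (fun r => Polynomial.coeff r k) h3
      simp only [Polynomial.finsetSum_coeff, Polynomial.coeff_C_mul, Polynomial.coeff_map,
        Polynomial.coeff_zero] at h4
      have h5 : ∑ j, (p j).coeff k • b j = 0 := by
        rw [← h4]
        exact Finset.sum_congr rfl fun j _ => by rw [Algebra.smul_def, mul_comm]
      simpa using (Fintype.linearIndependent_iff.mp b.linearIndependent) _ h5 i
    funext i
    have h6 := hp' i
    rw [hpz i, map_zero] at h6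
    rcases mul_eq_zero.mp h6.symm with h7 | h7
    · exact absurd h7 (RatFunc.algebraMap_ne_zero hq0)
    · exact sub_eq_zero.mp h7

/-- The components `ψ₀, …, ψₙ₋₁ ∈ K(t)` of a rational function `u ∈ K(α)(t)`, i.e. the unique
rational functions over `K` with `u = ψ₀ + α ψ₁ + ⋯ + α ^ (n - 1) ψₙ₋₁`. -/
def components [Algebra.IsAlgebraic K F] (α : F) (u : RatFunc K⟮α⟯) :
    Fin (Module.finrank K K⟮α⟯) → RatFunc K :=
  (existsUnique_components α u).choose

theorem components_spec [Algebra.IsAlgebraic K F] (α : F) (u : RatFunc K⟮α⟯) :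
    u = ∑ i : Fin (Module.finrank K K⟮α⟯), RatFunc.C (AdjoinSimple.gen K α ^ (i : ℕ)) *
      ratFuncMap K K⟮α⟯ (components α u i) :=
  (existsUnique_components α u).choose_spec.1

theorem components_unique [Algebra.IsAlgebraic K F] (α : F) (u : RatFunc K⟮α⟯)
    (ψ : Fin (Module.finrank K K⟮α⟯) → RatFunc K)
    (h : u = ∑ i : Fin (Module.finrank K K⟮α⟯), RatFunc.C (AdjoinSimple.gen K α ^ (i : ℕ)) * ratFuncMap K K⟮α⟯ (ψ i)) :
    ψ = components α u :=
  (existsUnique_components α u).choose_spec.2 ψ h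

end Components

/-- The parametric curve in `Fⁿ` given by `(ψ₀, …, ψₙ₋₁) ∈ K(t)ⁿ`: the Zariski closure of the set
of points `(ψ₀(s), …, ψₙ₋₁(s))`, where `s ∈ F` runs over the parameters at which all the `ψᵢ`
are defined. -/
def parametricCurve {K F : Type*} [Field K] [Field F] [Algebra K F] {n : ℕ}
    (ψ : Fin n → RatFunc K) : Set (Fin n → F) :=
  MvPolynomial.zeroLocus F (MvPolynomial.vanishingIdeal F
    {x : Fin n → F | ∃ s : F, (∀ i, Polynomial.aeval s (ψ i).denom ≠ 0) ∧
      ∀ i, x i = Polynomial.aeval s (ψ i).num / Polynomial.aeval s (ψ i).denom})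

/-- The linear fraction `(a t + b) / (t + d)` as an element of `L(t)`. -/
def linearFraction {L : Type*} [Field L] (a b d : L) : RatFunc L :=
  (RatFunc.C a * RatFunc.X + RatFunc.C b) / (RatFunc.X + RatFunc.C d)

/-- The `α`-hypercircle associated to a linear fraction `u ∈ K(α)(t)` for the extension
`K ⊆ K(α)`: the parametric curve in `Fⁿ`, `n = [K(α) : K]`, given by the components of `u`. -/
def hypercircle {K F : Type*} [Field K] [Field F] [Algebra K F] [Algebra.IsAlgebraic K F]
    (α : F) (u : RatFunc K⟮α⟯) : Set (Fin (Module.finrank K K⟮α⟯) → F) :=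
  parametricCurve (components α u)

/-- The projective closure in `ℙⁿ(F)` of a subset `Z` of `Fⁿ`, where `Fⁿ` is embedded by
`x ↦ [x₀ : ⋯ : xₙ₋₁ : 1]`: the set of common zeros of all the homogeneous polynomials that vanish
at the points of `Z`. -/
def projectiveClosure {F : Type*} [Field F] {n : ℕ} (Z : Set (Fin n → F)) :
    Set (ℙ F (Fin (n + 1) → F)) :=
  {P | ∀ (m : ℕ) (G : MvPolynomial (Fin (n + 1)) F), G.IsHomogeneous m →
    (∀ x ∈ Z, MvPolynomial.eval (Fin.snoc x 1 : Fin (n + 1) → F) G = 0) →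
      MvPolynomial.eval P.rep G = 0}

/-- `[a₀ : ⋯ : aₙ₋₁ : 0]` is a point at infinity of `Z ⊆ Fⁿ`: the `aᵢ` are not all zero, and
this point belongs to the projective closure of `Z`. -/
def IsPointAtInfinity {F : Type*} [Field F] {n : ℕ} (Z : Set (Fin n → F)) (a : Fin n → F) :
    Prop :=
  ∃ h : (Fin.snoc a 0 : Fin (n + 1) → F) ≠ 0, Projectivization.mk F _ h ∈ projectiveClosure Z

/-- The field generated over `K` by the coordinates of the point `[a₀ : ⋯ : aₙ₋₁ : 0]`
dehomogenized with respect to the index `i`, that is, by the `aⱼ / aᵢ`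
(used only when `aᵢ ≠ 0`). -/
def dehomogenizedField (K : Type*) {F : Type*} [Field K] [Field F] [Algebra K F] {n : ℕ}
    (a : Fin n → F) (i : Fin n) : IntermediateField K F :=
  IntermediateField.adjoin K (Set.range fun j => a j / a i)

end

end Hypercircle

namespace Hypercircle

/-! ### Homogeneous equations and the points at infinity -/

section ProjectiveClosure

variable {F : Type*} [Field F]

/-! Put `c = b - a * d`, which is nonzero. Applying a `K`-embedding `σ` of `K(α)` to the
decomposition gives `∑ σ(α)^i ψᵢ(s) = σ a + σ c / (s + σ d)`. The `n` embeddings separate `α`, so by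
Vandermonde these sums are linear coordinates on `Fⁿ` (`exists_conjugateEquiv`), in which the curve
has only simple poles, at the `-σ d`.

Each conjugate `δ` of `d` then gives exactly one point at infinity, the residue vector with entry `σ
c` where `σ d = δ` and `0` elsewhere (`exists_smul_of_isPointAtInfinity`,
`isPointAtInfinity_of_residue`).

An automorphism `τ` of `F` over `K` sends the vector of `δ` to that of `τ δ`, so the stabilizer of
the point is that of `δ`, and by Galois theory the ratios of its coordinates generate `K(δ)`
(`dehomogenizedField_residue`). Taking `δ = d` gives (2). Every other point at infinity is conjugate
to this one up to scaling, so it has an isomorphic field and the same nonzero coordinates. -/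

theorem eval_smul_of_isHomogeneous {ι : Type*} {G : MvPolynomial ι F} {m : ℕ}
    (hG : G.IsHomogeneous m) (r : F) (x : ι → F) :
    MvPolynomial.eval (r • x) G = r ^ m * MvPolynomial.eval x G := by
  rw [MvPolynomial.eval_eq, MvPolynomial.eval_eq, Finset.mul_sum]
  refine Finset.sum_congr rfl fun e he => ?_
  have hdeg : ∑ i ∈ e.support, e i = m := by
    rw [← hG (MvPolynomial.mem_support_iff.mp he)]
    simp [Finsupp.weight_apply, Finsupp.sum]
  simp only [Pi.smul_apply, smul_eq_mul, mul_pow, Finset.prod_mul_distrib,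
    Finset.prod_pow_eq_pow_sum, hdeg]
  ring

theorem mk_mem_projectiveClosure_iff {n : ℕ} {Z : Set (Fin n → F)} {v : Fin (n + 1) → F}
    (hv : v ≠ 0) :
    Projectivization.mk F v hv ∈ projectiveClosure Z ↔
      ∀ (m : ℕ) (G : MvPolynomial (Fin (n + 1)) F), G.IsHomogeneous m →
        (∀ x ∈ Z, MvPolynomial.eval (Fin.snoc x 1 : Fin (n + 1) → F) G = 0) →
          MvPolynomial.eval v G = 0 := by
  obtain ⟨r, hr⟩ := Projectivization.exists_smul_eq_mk_rep F v hv
  have hr0 : (r : F) ≠ 0 := r.ne_zero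
  refine forall₃_congr fun m G hG => imp_congr_right fun _ => ?_
  rw [← hr, Units.smul_def, eval_smul_of_isHomogeneous hG]
  simp [hr0]

/-- A polynomial vanishing at the points `(x, 1)`, `x ∈ S`, vanishes at the points `(x, 1)` for
`x` in the Zariski closure of `S`. -/
theorem eval_snoc_eq_zero_of_mem_zariskiClosure {n : ℕ} {S : Set (Fin n → F)}
    {G : MvPolynomial (Fin (n + 1)) F}
    (hG : ∀ x ∈ S, MvPolynomial.eval (Fin.snoc x 1 : Fin (n + 1) → F) G = 0) {x : Fin n → F}
    (hx : x ∈ MvPolynomial.zeroLocus F (MvPolynomial.vanishingIdeal F S)) :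
    MvPolynomial.eval (Fin.snoc x 1 : Fin (n + 1) → F) G = 0 := by
  have key : ∀ y : Fin n → F, MvPolynomial.aeval y
      (MvPolynomial.aeval (Fin.snoc MvPolynomial.X 1 : Fin (n + 1) → MvPolynomial (Fin n) F) G) =
        MvPolynomial.eval (Fin.snoc y 1 : Fin (n + 1) → F) G := by
    intro y
    rw [MvPolynomial.comp_aeval_apply]
    change _ = MvPolynomial.aeval (Fin.snoc y 1 : Fin (n + 1) → F) G
    congr 2
    funext i
    refine Fin.lastCases ?_ (fun j => ?_) i <;> simp
  rw [← key]
  refine MvPolynomial.mem_zeroLocus_iff.mp hx _ (MvPolynomial.mem_vanishingIdeal_iff.mpr ?_)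
  intro y hy
  rw [key]
  exact hG y hy

theorem subset_zariskiClosure {n : ℕ} (S : Set (Fin n → F)) :
    S ⊆ MvPolynomial.zeroLocus F (MvPolynomial.vanishingIdeal F S) := fun _ hx =>
  MvPolynomial.mem_zeroLocus_iff.mpr fun _ hp => MvPolynomial.mem_vanishingIdeal_iff.mp hp _ hx

/-- Homogeneous equations of a curve give equations of its points at infinity. -/
theorem eval_eq_zero_of_isPointAtInfinity {n : ℕ} {S : Set (Fin n → F)} {p : Fin n → F}
    (hp : IsPointAtInfinity (MvPolynomial.zeroLocus F (MvPolynomial.vanishingIdeal F S)) p)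
    {m : ℕ} {G : MvPolynomial (Fin (n + 1)) F} (hG : G.IsHomogeneous m)
    (hS : ∀ x ∈ S, MvPolynomial.eval (Fin.snoc x 1 : Fin (n + 1) → F) G = 0) :
    MvPolynomial.eval (Fin.snoc p 0 : Fin (n + 1) → F) G = 0 := by
  obtain ⟨h, hp⟩ := hp
  exact (mk_mem_projectiveClosure_iff h).mp hp m G hG fun x hx =>
    eval_snoc_eq_zero_of_mem_zariskiClosure hS hx

end ProjectiveClosure

/-! ### Curves with simple poles in linear coordinates -/

section Poles

variable {F : Type*} [Field F] {n : ℕ} {ι : Type*}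

theorem linearEquiv_apply_sum (V : (Fin n → F) ≃ₗ[F] (ι → F)) (x : Fin n → F)
    (σ : ι) : V x σ = ∑ j, V (Pi.single j 1) σ * x j := by
  conv_lhs => rw [← Finset.univ_sum_single x]
  rw [map_sum, Finset.sum_apply]
  refine Finset.sum_congr rfl fun j _ => ?_
  rw [← mul_one (x j), ← smul_eq_mul (x j) 1, Pi.single_smul, map_smul, Pi.smul_apply]
  simp [mul_comm]

/-- If, in suitable linear coordinates, the points of `S` have the form
`(A σ + C σ / (s + D σ))_σ`, then the points at infinity of the Zariski closure of `S` have
coordinates proportional to the residues at one of the poles. -/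
theorem exists_smul_of_isPointAtInfinity (V : (Fin n → F) ≃ₗ[F] (ι → F)) (A C D : ι → F)
    (hC : ∀ σ, C σ ≠ 0) {S : Set (Fin n → F)}
    (hS : ∀ x ∈ S, ∃ s : F, ∀ σ, s + D σ ≠ 0 ∧ V x σ = A σ + C σ / (s + D σ))
    {p : Fin n → F}
    (hp : IsPointAtInfinity (MvPolynomial.zeroLocus F (MvPolynomial.vanishingIdeal F S)) p)
    [DecidableEq F] :
    ∃ (τ : ι) (r : F), r ≠ 0 ∧ ∀ σ, V p σ = r * if D σ = D τ then C σ else 0 := by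
  classical
  let W : MvPolynomial (Fin (n + 1)) F := MvPolynomial.X (Fin.last n)
  let Y : ι → MvPolynomial (Fin (n + 1)) F := fun σ =>
    ∑ j : Fin n, MvPolynomial.C (V (Pi.single j 1) σ) * MvPolynomial.X j.castSucc
  -- Homogenization of the affine coordinate that equals `1 / (s + D σ)` on `S`.
  let Z : ι → MvPolynomial (Fin (n + 1)) F := fun σ =>
    MvPolynomial.C (C σ)⁻¹ * (Y σ - MvPolynomial.C (A σ) * W)
  have hZhom : ∀ σ, (Z σ).IsHomogeneous 1 := fun σ =>
    ((MvPolynomial.IsHomogeneous.sum _ _ _ fun j _ =>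
      MvPolynomial.isHomogeneous_C_mul_X _ _).sub (MvPolynomial.isHomogeneous_C_mul_X _ _)).C_mul _
  have hZ : ∀ (x : Fin n → F) (w : F) (σ : ι),
      MvPolynomial.eval (Fin.snoc x w : Fin (n + 1) → F) (Z σ) = (C σ)⁻¹ * (V x σ - A σ * w) := by
    intro x w σ
    rw [linearEquiv_apply_sum V x σ]
    simp [Z, Y, W]
  have hZS : ∀ x ∈ S, ∃ s : F, ∀ σ, s + D σ ≠ 0 ∧
      MvPolynomial.eval (Fin.snoc x 1 : Fin (n + 1) → F) (Z σ) = (s + D σ)⁻¹ := by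
    intro x hx
    obtain ⟨s, hs⟩ := hS x hx
    refine ⟨s, fun σ => ⟨(hs σ).1, ?_⟩⟩
    rw [hZ, (hs σ).2]
    field_simp [hC σ, (hs σ).1]
    ring
  have hlin : ∀ σ τ, D σ = D τ → (C σ)⁻¹ * V p σ = (C τ)⁻¹ * V p τ := by
    intro σ τ h
    have := eval_eq_zero_of_isPointAtInfinity hp ((hZhom σ).sub (hZhom τ)) (by
      intro x hx
      obtain ⟨s, hs⟩ := hZS x hx
      rw [map_sub, (hs σ).2, (hs τ).2, h, sub_self])
    simpa [hZ, sub_eq_zero] using this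
  -- Partial fractions: `Z σ - Z τ = (D τ - D σ) Z σ Z τ` on `S`. Homogenized, the left side carries
  -- the factor `W`, which is zero at infinity, so only the product survives.
  have hquad : ∀ σ τ, D σ ≠ D τ → V p σ = 0 ∨ V p τ = 0 := by
    intro σ τ h
    have := eval_eq_zero_of_isPointAtInfinity hp
      (((MvPolynomial.isHomogeneous_X F (Fin.last n)).mul ((hZhom σ).sub (hZhom τ))).sub
        (((hZhom σ).mul (hZhom τ)).C_mul (D τ - D σ))) (by
      intro x hx
      obtain ⟨s, hs⟩ := hZS x hx
      have h1 := (hs σ).1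
      have h2 := (hs τ).1
      simp only [map_sub, map_mul, (hs σ).2, (hs τ).2, MvPolynomial.eval_C, MvPolynomial.eval_X,
        Fin.snoc_last]
      field_simp
      ring)
    simpa [hZ, sub_eq_zero, hC, Ne.symm h] using this
  have hp0 : V p ≠ 0 := by
    rw [Ne, LinearEquiv.map_eq_zero_iff]
    rintro rfl
    obtain ⟨h, -⟩ := hp
    apply h
    funext i
    refine Fin.lastCases ?_ (fun j => ?_) i <;> simp
  obtain ⟨τ, hτ⟩ := Function.ne_iff.mp hp0
  rw [Pi.zero_apply] at hτ
  refine ⟨τ, (C τ)⁻¹ * V p τ, mul_ne_zero (inv_ne_zero (hC τ)) hτ, fun σ => ?_⟩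
  split_ifs with h
  · rw [← hlin σ τ h]
    field_simp [hC σ]
  · rw [mul_zero]
    exact (hquad σ τ h).resolve_right hτ

/-- The residues of a parametrization with simple poles are points at infinity. -/
theorem isPointAtInfinity_of_residue [Infinite F] [Fintype ι] (V : (Fin n → F) ≃ₗ[F] (ι → F)) (A C D : ι → F)
    {S : Set (Fin n → F)}
    (hS : {s : F | V.symm (fun σ => A σ + C σ / (s + D σ)) ∉ S}.Finite)
    [DecidableEq F] {τ : ι} (hτ : C τ ≠ 0) {q : Fin n → F}
    (hq : ∀ σ, V q σ = if D σ = D τ then C σ else 0) :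
    IsPointAtInfinity (MvPolynomial.zeroLocus F (MvPolynomial.vanishingIdeal F S)) q := by
  classical
  have hq0 : (Fin.snoc q 0 : Fin (n + 1) → F) ≠ 0 := by
    intro h
    have : q = 0 := by
      funext j
      simpa using congrFun h j.castSucc
    have h2 := hq τ
    rw [this, map_zero, if_pos rfl] at h2
    exact hτ h2.symm
  refine ⟨hq0, (mk_mem_projectiveClosure_iff hq0).mpr fun m G hG hGS => ?_⟩
  -- The distinct values of `D`, each taken once: `g` has simple roots, so clearing denominators
  -- leaves a nonzero residue at each pole.
  let Δ : Finset F := Finset.univ.image D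
  have hΔ : ∀ σ, D σ ∈ Δ := fun σ => Finset.mem_image_of_mem _ (Finset.mem_univ σ)
  let g : F[X] := ∏ δ ∈ Δ, (X + Polynomial.C δ)
  let f : ι → F[X] := fun σ => Polynomial.C (A σ) * g +
    Polynomial.C (C σ) * ∏ δ ∈ Δ.erase (D σ), (X + Polynomial.C δ)
  -- The parametrization with denominators cleared, which can also be evaluated at the poles.
  let Q : Fin (n + 1) → F[X] := Fin.snoc
    (fun j => ∑ σ, f σ * Polynomial.C (V.symm (Pi.single σ 1) j)) g
  have hQ : ∀ s : F, (fun i => (Q i).eval s) =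
      (Fin.snoc (V.symm fun σ => (f σ).eval s) (g.eval s) : Fin (n + 1) → F) := by
    intro s
    funext i
    refine Fin.lastCases (by simp [Q]) (fun j => ?_) i
    have : V.symm (fun σ => (f σ).eval s) j =
        ∑ σ, (f σ).eval s * V.symm (Pi.single σ 1) j := by
      rw [pi_eq_sum_univ' (fun σ => (f σ).eval s)]
      simp [Finset.sum_apply, Pi.single]
    simp [Q, this, eval_finsetSum]
  let h : F[X] := MvPolynomial.aeval Q G
  have hh : ∀ s : F, h.eval s =
      MvPolynomial.eval (Fin.snoc (V.symm fun σ => (f σ).eval s) (g.eval s) : Fin (n + 1) → F) G := by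
    intro s
    rw [← hQ, ← MvPolynomial.coe_aeval_eq_eval, ← Polynomial.coe_aeval_eq_eval]
    exact MvPolynomial.comp_aeval_apply (φ := Polynomial.aeval s) (f := Q) G
  have hge : ∀ s : F, g.eval s = ∏ δ ∈ Δ, (s + δ) := by
    intro s
    simp [g, eval_prod]
  have hfe : ∀ (s : F) σ, (f σ).eval s =
      A σ * g.eval s + C σ * ∏ δ ∈ Δ.erase (D σ), (s + δ) := by
    intro s σ
    simp [f, eval_prod]
  -- For all but finitely many `s`, `Q(s)` is a multiple of a point `(x, 1)` with `x ∈ S`, where `G`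
  -- vanishes.
  have hzero : h = 0 := by
    refine Polynomial.eq_zero_of_infinite_isRoot _ ?_
    have hfin : ({s : F | V.symm (fun σ => A σ + C σ / (s + D σ)) ∉ S} ∪
        (Δ.image fun δ => -δ : Finset F)).Finite := hS.union (Finset.finite_toSet _)
    refine hfin.infinite_compl.mono fun s hs => ?_
    simp only [Set.mem_compl_iff, Set.mem_union, Set.mem_ofPred_eq, not_or, not_not, Finset.mem_coe,
      Finset.mem_image, not_exists, not_and] at hs
    have hs0 : ∀ σ, s + D σ ≠ 0 := fun σ h0 => hs.2 (D σ) (hΔ σ) (by linear_combination -h0)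
    have hmul : (Fin.snoc (V.symm fun σ => (f σ).eval s) (g.eval s) : Fin (n + 1) → F) =
        g.eval s • (Fin.snoc (V.symm fun σ => A σ + C σ / (s + D σ)) 1 : Fin (n + 1) → F) := by
      have : (fun σ => (f σ).eval s) = g.eval s • fun σ => A σ + C σ / (s + D σ) := by
        funext σ
        rw [hfe, Pi.smul_apply, smul_eq_mul, hge, ← Finset.mul_prod_erase Δ _ (hΔ σ)]
        field_simp [hs0 σ]
      rw [this, map_smul]
      funext i
      refine Fin.lastCases (by simp) (fun j => by simp) i
    rw [Set.mem_ofPred_eq, Polynomial.IsRoot, hh, hmul, eval_smul_of_isHomogeneous hG,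
      hGS _ (subset_zariskiClosure S hs.1), mul_zero]
  have hend := hh (-D τ)
  -- At the pole `-D τ` the cleared parametrization is a nonzero multiple of `(q, 0)`.
  have hmul : (Fin.snoc (V.symm fun σ => (f σ).eval (-D τ)) (g.eval (-D τ)) : Fin (n + 1) → F) =
      (∏ δ ∈ Δ.erase (D τ), (-D τ + δ)) • (Fin.snoc q 0 : Fin (n + 1) → F) := by
    have hg0 : g.eval (-D τ) = 0 := by
      rw [hge]
      exact Finset.prod_eq_zero (hΔ τ) (neg_add_cancel _)
    have : (fun σ => (f σ).eval (-D τ)) = (∏ δ ∈ Δ.erase (D τ), (-D τ + δ)) • V q := by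
      funext σ
      rw [hfe, hg0, mul_zero, zero_add, Pi.smul_apply, hq, smul_eq_mul]
      split_ifs with h
      · rw [h, mul_comm]
      · rw [Finset.prod_eq_zero (Finset.mem_erase.mpr ⟨Ne.symm h, hΔ τ⟩) (neg_add_cancel _)]
        simp
    rw [this, map_smul, hg0, LinearEquiv.symm_apply_apply]
    funext i
    refine Fin.lastCases (by simp) (fun j => by simp) i
  rw [hzero, hmul, eval_smul_of_isHomogeneous hG, eval_zero] at hend
  refine (mul_eq_zero.mp hend.symm).resolve_left (pow_ne_zero _ (Finset.prod_ne_zero_iff.mpr ?_))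
  intro δ hδ h0
  exact (Finset.mem_erase.mp hδ).1 (by linear_combination h0)

end Poles

/-! ### Conjugation coordinates and the Galois action -/

section Conjugates

variable {K F : Type*} [Field K] [Field F] [Algebra K F]

/-- The matrix is Vandermonde in the conjugates of `α`. They are distinct because an embedding is
determined by its value at `α`, and separability provides exactly `n` of them. -/
theorem exists_conjugateEquiv [CharZero K] [IsAlgClosed F] [Algebra.IsAlgebraic K F] (α : F) :
    ∃ V : (Fin (Module.finrank K K⟮α⟯) → F) ≃ₗ[F] ((K⟮α⟯ →ₐ[K] F) → F),
      ∀ x σ, V x σ = ∑ i : Fin (Module.finrank K K⟮α⟯), σ (AdjoinSimple.gen K α) ^ (i : ℕ) * x i := by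
  have hα : IsIntegral K α := (Algebra.IsAlgebraic.isAlgebraic α).isIntegral
  have : FiniteDimensional K K⟮α⟯ := adjoin.finiteDimensional hα
  have hcard := AlgHom.card K K⟮α⟯ F
  let e : Fin (Module.finrank K K⟮α⟯) ≃ (K⟮α⟯ →ₐ[K] F) :=
    (finCongr hcard.symm).trans (Fintype.equivFin _).symm
  let f : (Fin (Module.finrank K K⟮α⟯) → F) →ₗ[F] ((K⟮α⟯ →ₐ[K] F) → F) :=
    Matrix.mulVecLin (Matrix.of fun σ i => σ (AdjoinSimple.gen K α) ^ (i : ℕ))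
  have hf : ∀ x σ, f x σ = ∑ i : Fin (Module.finrank K K⟮α⟯), σ (AdjoinSimple.gen K α) ^ (i : ℕ) * x i := fun x σ => rfl
  have hinj : Function.Injective f := by
    rw [injective_iff_map_eq_zero]
    intro x hx
    refine Matrix.eq_zero_of_mulVec_eq_zero
      (M := Matrix.vandermonde fun i => e i (AdjoinSimple.gen K α)) ?_ ?_
    · rw [Matrix.det_vandermonde_ne_zero_iff]
      intro i j hij
      apply e.injective
      exact algHom_ext_of_eq_adjoin _ rfl fun y hy => by
        obtain rfl : y = α := hy
        exact hij
    · funext i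
      exact congrFun hx (e i)
  exact ⟨LinearMap.linearEquivOfInjective f hinj (by simp [hcard]), hf⟩

/-- Evaluating the components of `(a t + b) / (t + d)` at `s` gives the conjugates of the value. -/
theorem conjugate_eval_components [Algebra.IsAlgebraic K F] (α : F) (a b d : K⟮α⟯)
    (hunit : a * d - b ≠ 0) (σ : K⟮α⟯ →ₐ[K] F) (s : F)
    (hs : ∀ i, aeval s (components α (linearFraction a b d) i).denom ≠ 0) :
    s + σ d ≠ 0 ∧ ∑ i : Fin (Module.finrank K K⟮α⟯), σ (AdjoinSimple.gen K α) ^ (i : ℕ) *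
      (aeval s (components α (linearFraction a b d) i).num /
        aeval s (components α (linearFraction a b d) i).denom) =
      σ a + σ (b - a * d) / (s + σ d) := by
  classical
  set ψ := components α (linearFraction a b d) with hψ
  let g : K[X] := ∏ i, (ψ i).denom
  let N : Fin (Module.finrank K K⟮α⟯) → K[X] := fun i =>
    (ψ i).num * ∏ j ∈ Finset.univ.erase i, (ψ j).denom
  have hgN : ∀ i, g = (ψ i).denom * ∏ j ∈ Finset.univ.erase i, (ψ j).denom := fun i =>
    (Finset.mul_prod_erase _ _ (Finset.mem_univ i)).symm
  have hN : ∀ i, algebraMap K[X] (RatFunc K) g * ψ i = algebraMap K[X] (RatFunc K) (N i) := by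
    intro i
    have h1 : algebraMap K[X] (RatFunc K) (ψ i).denom * ψ i = algebraMap _ _ (ψ i).num := by
      have h0 : algebraMap K[X] (RatFunc K) (ψ i).denom ≠ 0 :=
        RatFunc.algebraMap_ne_zero (ψ i).denom_ne_zero
      rw [mul_comm, ← eq_div_iff h0, RatFunc.num_div_denom]
    rw [hgN i, map_mul, mul_right_comm, h1, ← map_mul]
  have hXd : (RatFunc.X + RatFunc.C d : RatFunc K⟮α⟯) ≠ 0 := by
    have := RatFunc.algebraMap_ne_zero (Polynomial.X_add_C_ne_zero d)
    rwa [map_add, RatFunc.algebraMap_X, RatFunc.algebraMap_C] at this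
  -- With denominators cleared, the identity can be specialized through `σ` at any `s`, even before
  -- `s + σ d ≠ 0` is known.
  have hpoly : (∑ i : Fin (Module.finrank K K⟮α⟯), Polynomial.C (AdjoinSimple.gen K α ^ (i : ℕ)) *
      (N i).map (algebraMap K K⟮α⟯)) * (X + Polynomial.C d) =
      (Polynomial.C a * X + Polynomial.C b) * g.map (algebraMap K K⟮α⟯) := by
    apply RatFunc.algebraMap_injective K⟮α⟯
    have hspec := components_spec α (linearFraction a b d)
    rw [← hψ, linearFraction, div_eq_iff hXd] at hspec
    simp only [map_sum, map_mul, map_add, RatFunc.algebraMap_X, RatFunc.algebraMap_C,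
      ← ratFuncMap_algebraMap, ← hN, hspec]
    simp only [mul_left_comm _ (ratFuncMap K K⟮α⟯ _) _, ← Finset.mul_sum]
    ring
  have hσ : ∀ p : K[X], eval₂ (σ : K⟮α⟯ →+* F) s (p.map (algebraMap K K⟮α⟯)) = aeval s p := by
    intro p
    rw [eval₂_map, aeval_def]
    congr 1
    ext x
    simp
  have heval := congrArg (eval₂ (σ : K⟮α⟯ →+* F) s) hpoly
  simp only [eval₂_mul, eval₂_finsetSum, eval₂_pow, eval₂_add, eval₂_C, eval₂_X, hσ, RingHom.coe_coe,
    map_pow] at heval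
  have hgs : aeval s g ≠ 0 := by
    rw [map_prod]
    exact Finset.prod_ne_zero_iff.mpr fun i _ => hs i
  have hNs : ∀ i, aeval s (N i) = aeval s g * (aeval s (ψ i).num / aeval s (ψ i).denom) := by
    intro i
    rw [hgN i, map_mul, map_mul]
    field_simp [hs i]
  simp only [hNs, mul_left_comm _ (aeval s g) _, ← Finset.mul_sum] at heval
  set y := ∑ i : Fin (Module.finrank K K⟮α⟯), σ (AdjoinSimple.gen K α) ^ (i : ℕ) *
    (aeval s (ψ i).num / aeval s (ψ i).denom)
  have hy : y * (s + σ d) = σ a * s + σ b := by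
    apply mul_left_cancel₀ hgs
    linear_combination heval
  -- A zero here would make `σ a * s + σ b` vanish at `s = -σ d`, that is, `σ (a * d - b) = 0`.
  have hsd : s + σ d ≠ 0 := by
    intro h0
    apply hunit
    apply σ.injective
    rw [h0, mul_zero] at hy
    rw [map_zero, map_sub, map_mul]
    linear_combination hy + σ a * h0
  refine ⟨hsd, ?_⟩
  rw [map_sub, map_mul]
  field_simp
  linear_combination hy

theorem exists_algEquiv_apply_eq [Normal K F] {E : IntermediateField K F}
    (σ : E →ₐ[K] F) : ∃ τ : F ≃ₐ[K] F, ∀ x : E, τ x = σ x := by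
  refine ⟨AlgEquiv.ofBijective (σ.liftNormal F)
    (Algebra.IsAlgebraic.algHom_bijective _), fun x => ?_⟩
  exact σ.liftNormal_commutes F x

/-- The value of the conjugation coordinates on Galois conjugate vectors. -/
theorem conjugateEquiv_algEquiv_comp {α : F}
    {V : (Fin (Module.finrank K K⟮α⟯) → F) ≃ₗ[F] ((K⟮α⟯ →ₐ[K] F) → F)}
    (hV : ∀ x σ, V x σ = ∑ i : Fin (Module.finrank K K⟮α⟯), σ (AdjoinSimple.gen K α) ^ (i : ℕ) * x i)
    (τ : F ≃ₐ[K] F) (x : Fin (Module.finrank K K⟮α⟯) → F) (σ : K⟮α⟯ →ₐ[K] F) :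
    V (fun i => τ (x i)) σ = τ (V x ((τ.symm : F →ₐ[K] F).comp σ)) := by
  simp [hV, map_sum]

theorem eq_of_fixingSubgroup_eq [IsGalois K F] {E₁ E₂ : IntermediateField K F}
    (h : ∀ τ : F ≃ₐ[K] F, (∀ x ∈ E₁, τ x = x) ↔ ∀ x ∈ E₂, τ x = x) : E₁ = E₂ := by
  rw [← InfiniteGalois.fixedField_fixingSubgroup E₁, ← InfiniteGalois.fixedField_fixingSubgroup E₂]
  congr 1
  ext τ
  rw [IntermediateField.mem_fixingSubgroup_iff, IntermediateField.mem_fixingSubgroup_iff]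
  exact h τ

theorem algEquiv_fixes_adjoin_iff (S : Set F) (τ : F ≃ₐ[K] F) :
    (∀ x ∈ adjoin K S, τ x = x) ↔ ∀ x ∈ S, τ x = x :=
  forall_mem_adjoin_smul_eq_self_iff K τ

theorem dehomogenizedField_smul {n : ℕ} (e : Fin n → F) (i : Fin n) {r : F} (hr : r ≠ 0) :
    dehomogenizedField K (r • e) i = dehomogenizedField K e i := by
  simp only [dehomogenizedField, Pi.smul_apply, smul_eq_mul, mul_div_mul_left _ _ hr]

variable [DecidableEq F] {α : F} {V : (Fin (Module.finrank K K⟮α⟯) → F) ≃ₗ[F] ((K⟮α⟯ →ₐ[K] F) → F)}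
  {c d : K⟮α⟯} {δ : F} {e : Fin (Module.finrank K K⟮α⟯) → F}

/-- Galois acts on residue vectors through the poles: `τ` turns the vector of `δ` into that of `τ
δ`, with the same `c`. -/
theorem conjugateEquiv_residue_algEquiv
    (hV : ∀ x σ, V x σ = ∑ i : Fin (Module.finrank K K⟮α⟯), σ (AdjoinSimple.gen K α) ^ (i : ℕ) * x i)
    (he : ∀ σ, V e σ = if σ d = δ then σ c else 0) (τ : F ≃ₐ[K] F) (σ : K⟮α⟯ →ₐ[K] F) :
    V (fun i => τ (e i)) σ = if σ d = τ δ then σ c else 0 := by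
  rw [conjugateEquiv_algEquiv_comp hV, he]
  change τ (if τ.symm (σ d) = δ then τ.symm (σ c) else 0) = _
  simp only [AlgEquiv.symm_apply_eq]
  split_ifs <;> simp

theorem algEquiv_residue_eq_self
    (hV : ∀ x σ, V x σ = ∑ i : Fin (Module.finrank K K⟮α⟯), σ (AdjoinSimple.gen K α) ^ (i : ℕ) * x i)
    (he : ∀ σ, V e σ = if σ d = δ then σ c else 0) {τ : F ≃ₐ[K] F} (hτ : τ δ = δ)
    (j : Fin (Module.finrank K K⟮α⟯)) : τ (e j) = e j := by
  refine congrFun (V.injective (a₁ := fun i => τ (e i)) ?_) j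
  funext σ
  rw [conjugateEquiv_residue_algEquiv hV he, hτ, he]

/-- Residue vectors at distinct poles have disjoint supports, so `τ` fixes the projective point only
if it fixes `δ`. The embedding `σ₀` ensures that the support is nonempty. -/
theorem dehomogenizedField_residue [IsGalois K F]
    (hV : ∀ x σ, V x σ = ∑ i : Fin (Module.finrank K K⟮α⟯), σ (AdjoinSimple.gen K α) ^ (i : ℕ) * x i) (hc : c ≠ 0)
    (he : ∀ σ, V e σ = if σ d = δ then σ c else 0) {σ₀ : K⟮α⟯ →ₐ[K] F} (hσ₀ : σ₀ d = δ)
    {i : Fin (Module.finrank K K⟮α⟯)} (hi : e i ≠ 0) :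
    dehomogenizedField K e i = K⟮δ⟯ := by
  refine eq_of_fixingSubgroup_eq fun τ => ?_
  rw [dehomogenizedField, algEquiv_fixes_adjoin_iff, algEquiv_fixes_adjoin_iff]
  simp only [Set.forall_mem_range, Set.mem_singleton_iff, forall_eq]
  constructor
  · intro h
    have hτi : τ (e i) ≠ 0 := by simpa using hi
    -- Fixing all the ratios means that `τ` maps `e` to a multiple of itself.
    have hsmul : (fun j => τ (e j)) = (τ (e i) / e i) • e := by
      funext j
      have := h j
      rw [map_div₀, div_eq_div_iff hτi hi] at this
      rw [Pi.smul_apply, smul_eq_mul, div_mul_eq_mul_div, eq_div_iff hi, this, mul_comm]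
    have h1 := conjugateEquiv_residue_algEquiv hV he τ σ₀
    rw [hsmul, map_smul, Pi.smul_apply, he, if_pos hσ₀, smul_eq_mul] at h1
    by_contra hne
    rw [if_neg (by rw [hσ₀]; exact Ne.symm hne)] at h1
    exact mul_ne_zero (div_ne_zero hτi hi) (by simpa using hc) h1
  · intro h j
    rw [map_div₀, algEquiv_residue_eq_self hV he h, algEquiv_residue_eq_self hV he h]

end Conjugates

end Hypercircle

theorem mainTheorem8 {K : Type*} [Field K] [CharZero K] {F : Type*} [Field F] [Algebra K F]
    [IsAlgClosure K F] (α : F) (a b d : K⟮α⟯) (hunit : a * d - b ≠ 0)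
    (U : Set (Fin (Module.finrank K K⟮α⟯) → F))
    (hU : U = Hypercircle.hypercircle α (Hypercircle.linearFraction a b d)) :
    (∀ p : Fin (Module.finrank K K⟮α⟯) → F,
      (∀ j, p j ∈ K⟮α⟯) → Hypercircle.IsPointAtInfinity U p →
        ∀ i, p i ≠ 0 →
          Nonempty (Hypercircle.dehomogenizedField K p i ≃ₐ[K] K⟮(d : F)⟯)) ∧
    (∃ q : Fin (Module.finrank K K⟮α⟯) → F,
      (∀ j, q j ∈ K⟮α⟯) ∧ Hypercircle.IsPointAtInfinity U q ∧
        (∀ i, q i ≠ 0 → Hypercircle.dehomogenizedField K q i = K⟮(d : F)⟯) ∧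
        (∀ p : Fin (Module.finrank K K⟮α⟯) → F,
          (∀ j, p j ∈ K⟮α⟯) → Hypercircle.IsPointAtInfinity U p →
            ∀ i, p i ≠ 0 → q i ≠ 0)) := by
  classical
  subst hU
  have : Algebra.IsAlgebraic K F := IsAlgClosure.isAlgebraic
  have : IsAlgClosed F := IsAlgClosure.isAlgClosed K
  have : IsGalois K F := IsAlgClosure.isGalois K F
  have : Infinite F := IsAlgClosed.instInfinite
  have : FiniteDimensional K K⟮α⟯ :=
    adjoin.finiteDimensional (Algebra.IsAlgebraic.isAlgebraic α).isIntegral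
  obtain ⟨V, hV⟩ := Hypercircle.exists_conjugateEquiv (K := K) α
  set c : K⟮α⟯ := b - a * d with hc_def
  have hc : c ≠ 0 := fun h => hunit (by linear_combination -h)
  have hcσ : ∀ σ : K⟮α⟯ →ₐ[K] F, σ c ≠ 0 := fun σ => by simpa using hc
  set ψ := Hypercircle.components α (Hypercircle.linearFraction a b d) with hψ
  let x : F → Fin (Module.finrank K K⟮α⟯) → F := fun s i =>
    aeval s (ψ i).num / aeval s (ψ i).denom
  have hx : ∀ s, (∀ i, aeval s (ψ i).denom ≠ 0) →
      ∀ σ : K⟮α⟯ →ₐ[K] F, s + σ d ≠ 0 ∧ V (x s) σ = σ a + σ c / (s + σ d) := by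
    intro s hs σ
    rw [hV]
    exact Hypercircle.conjugate_eval_components α a b d hunit σ s hs
  -- the points at infinity are the residue vectors, up to scaling
  have hinf : ∀ p, Hypercircle.IsPointAtInfinity
      (Hypercircle.hypercircle α (Hypercircle.linearFraction a b d)) p →
      ∃ (τ : K⟮α⟯ →ₐ[K] F) (r : F), r ≠ 0 ∧
        ∀ σ, V p σ = r * if σ d = τ d then σ c else 0 := by
    intro p hp
    refine Hypercircle.exists_smul_of_isPointAtInfinity V (fun σ => σ a) (fun σ => σ c)
      (fun σ => σ d) hcσ ?_ hp
    rintro y ⟨s, hs, hy⟩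
    obtain rfl : y = x s := funext hy
    exact ⟨s, hx s hs⟩
  -- The residue vector at `-d`, the pole belonging to the inclusion `K(α) ⊆ F`.
  let q : Fin (Module.finrank K K⟮α⟯) → F := V.symm fun σ => if σ d = (d : F) then σ c else 0
  have hq : ∀ σ, V q σ = if σ d = (d : F) then σ c else 0 := fun σ => by
    rw [LinearEquiv.apply_symm_apply]
  have hqinf : Hypercircle.IsPointAtInfinity
      (Hypercircle.hypercircle α (Hypercircle.linearFraction a b d)) q := by
    refine Hypercircle.isPointAtInfinity_of_residue V (fun σ => σ a) (fun σ => σ c)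
      (fun σ => σ d) ?_ (hcσ K⟮α⟯.val) hq
    refine (Set.finite_iUnion fun i => (rootSet_finite (ψ i).denom F)).subset fun s hs => ?_
    by_contra hs'
    simp only [Set.mem_iUnion, mem_rootSet, not_exists, not_and] at hs'
    have hs0 : ∀ i, aeval s (ψ i).denom ≠ 0 := fun i => hs' i (ψ i).denom_ne_zero
    apply hs
    refine ⟨s, hs0, fun i => ?_⟩
    have : (fun σ : K⟮α⟯ →ₐ[K] F => σ a + σ c / (s + σ d)) = V (x s) :=
      funext fun σ => (hx s hs0 σ).2.symm
    rw [this, LinearEquiv.symm_apply_apply]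
  have hfield : ∀ i, q i ≠ 0 → Hypercircle.dehomogenizedField K q i = K⟮(d : F)⟯ := fun i hi =>
    Hypercircle.dehomogenizedField_residue hV hc hq (σ₀ := K⟮α⟯.val) rfl hi
  -- every point at infinity is a multiple of a conjugate of `q`
  have hconj : ∀ p, Hypercircle.IsPointAtInfinity
      (Hypercircle.hypercircle α (Hypercircle.linearFraction a b d)) p →
      ∃ (τ : F ≃ₐ[K] F) (r : F), r ≠ 0 ∧ p = r • fun i => τ (q i) := by
    intro p hp
    obtain ⟨σ₀, r, hr, h⟩ := hinf p hp
    obtain ⟨τ, hτ⟩ := Hypercircle.exists_algEquiv_apply_eq σ₀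
    refine ⟨τ, r, hr, V.injective (funext fun σ => ?_)⟩
    rw [h, map_smul, Pi.smul_apply, smul_eq_mul,
      Hypercircle.conjugateEquiv_residue_algEquiv hV hq, hτ]
  refine ⟨fun p _ hp i hi => ?_, q, fun j => ?_, hqinf, hfield, fun p _ hp i hi => ?_⟩
  · obtain ⟨τ, r, hr, rfl⟩ := hconj p hp
    have hqi : q i ≠ 0 := fun h => hi (by simp [h])
    have hmap : Hypercircle.dehomogenizedField K (r • fun i => τ (q i)) i =
        (K⟮(d : F)⟯).map (τ : F →ₐ[K] F) := by
      rw [Hypercircle.dehomogenizedField_smul _ _ hr, ← hfield i hqi,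
        Hypercircle.dehomogenizedField, Hypercircle.dehomogenizedField, adjoin_map,
        ← Set.range_comp]
      simp [Function.comp_def]
    rw [hmap]
    exact ⟨(intermediateFieldMap τ _).symm⟩
  -- An automorphism fixing `K(α)` fixes `d`, hence the residue vector `q`; so the coordinates of
  -- `q` lie in `K(α)`.
  · rw [← InfiniteGalois.fixedField_fixingSubgroup K⟮α⟯, mem_fixedField_iff]
    intro τ hτ
    exact Hypercircle.algEquiv_residue_eq_self hV hq
      ((IntermediateField.mem_fixingSubgroup_iff _ _).mp hτ _ d.2) j
  · obtain ⟨τ, r, -, rfl⟩ := hconj p hp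
    exact fun h => hi (by simp [h])
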